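/- Consider a cellular network with $K$ small-cell base stations (SBSs), $J$ mobile users (MUs), file size $M>0$, and a library of $NG$ files with popularity distribution $(p_f)_{f=1}^{NG}$ (a probability vector), divided into $N$ groups $\mathcal F_n=\{(n-1)G+1,\dots,nG\}$ with $P_{\mathcal F_n}=\sum_{f\in\mathcal F_n}p_f$. For a given realization of the channel coefficients $h_{k,j}\in\mathbb R$, with distances $d_{k,j}>0$, path-loss exponent $\alpha>0$, transmission powers $P_k>0$, noise power $\sigma^2>0$, bandwidth $W>0$, macro-cell rate $C_0>0$ and SINR threshold $\delta>0$, put $$\mathrm{SINR}_{k,j}=\frac{h_{k,j}^2d_{k,j}^{-\alpha}P_k}{\sum_{q\ne k}h_{q,j}^2d_{q,j}^{-\alpha}P_q+\sigma^2},\qquad C_{k,j}=W\log(1+\mathrm{SINR}_{k,j}).$$ Let $\mathcal H(j)=\{k:\mathrm{SINR}_{k,j}\ge\delta\}$ and $\mathcal H(k)=\{j:\mathrm{SINR}_{k,j}\ge\delta\}$ be the neighbourhoods in the factor graph. If SBS $h$ stores the single group indicated by the $0$-$1$ vector $\boldsymbol\lambda_h=(\lambda_{h,1},\dots,\lambda_{h,N})$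 for $h\in\mathcal H(j)$, the utility of MU $j$ is $F_j=-\sum_{n}P_{\mathcal F_n}D_{j,n}$, where $D_{j,n}=M/\max_{h\in\mathcal H(j)}\lambda_{h,n}C_{h,j}$ if $\lambda_{h,n}\neq0$ for some $h\in\mathcal H(j)$, and $D_{j,n}=M/C_0$ otherwise. Let $\boldsymbol\lambda^{[n]}$ be the $n$-th unit vector of length $N$, and let $\mu>0$. One iteration of the distributed belief propagation (BP) algorithm maps a collection of messages $m=(m_{k\to j}(n))_{k\le K,\,j\le J,\,n\le N}$ from the SBSs to the MUs to the collection $\Gamma(m)$, where $$\Gamma(m)_{k\to j}(n)=\frac1{Z_{k,j}}\prod_{i\in\mathcal H(k)\setminus\{j\}}r_{i\to k}(n),$$ $$r_{i\to k}(n)=\sum_{(n_h)\in\{1,\dots,N\}^{\mathcal H(i)\setminus\{k\}}}\exp\Big(\mu F_i\big(\boldsymbol\lambda_k=\boldsymbol\lambda^{[n]},\ \boldsymbol\lambda_h=\boldsymbol\lambda^{[n_h]}\ \text{for}\ h\in\mathcal H(i)\setminus\{k\}\big)\Big)\prod_{q\in\mathcal H(i)\setminus\{k\}}m_{q\to i}(n_q),$$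 and $Z_{k,j}$ is the normalization factor making $\sum_n\Gamma(m)_{k\to j}(n)=1$. Let $\mathcal S$ be the set of collections $m$ in which every $(m_{k\to j}(n))_{n\le N}$ is a probability vector. **Theorem.** $\Gamma$ maps $\mathcal S$ to $\mathcal S$, is continuous on $\mathcal S$, and has a fixed point in $\mathcal S$: there is $m\in\mathcal S$ with $\Gamma(m)=m$. -/

import Mathlib

/-- A heterogeneous cellular network with `K` small-cell base stations (SBSs), `J` mobile users
(MUs) and a library of `N * G` files, cut into `N` file groups of `G` consecutive files,
for one given realization of the channel coefficients. -/
structure HCN (K J N G : ℕ) where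
  /-- bandwidth `W` -/
  W : ℝ
  W_pos : 0 < W
  /-- transmission power `P k` of the `k`-th SBS -/
  P : Fin K → ℝ
  P_pos : ∀ k, 0 < P k
  /-- the noise power at each user is `σ ^ 2` -/
  σ : ℝ
  σ_pos : 0 < σ
  /-- path-loss exponent -/
  α : ℝ
  α_pos : 0 < α
  /-- distance between SBS `k` and user `j` -/
  d : Fin K → Fin J → ℝ
  d_pos : ∀ k j, 0 < d k j
  /-- realization of the channel coefficient between SBS `k` and user `j` -/
  h : Fin K → Fin J → ℝ
  /-- download rate of the macro base station -/
  C₀ : ℝ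
  C₀_pos : 0 < C₀
  /-- file size in bits -/
  M : ℝ
  M_pos : 0 < M
  /-- SINR threshold -/
  δ : ℝ
  δ_pos : 0 < δ
  /-- popularity distribution of the files -/
  p : Fin (N * G) → ℝ
  p_nonneg : ∀ f, 0 ≤ p f
  p_sum : ∑ f, p f = 1

namespace HCN

noncomputable section

variable {K J N G : ℕ} (net : HCN K J N G)

/-- Signal-to-interference-plus-noise ratio at user `j` of the signal from SBS `k`. -/
def sinr (k : Fin K) (j : Fin J) : ℝ :=
  (net.h k j ^ 2 * net.d k j ^ (-net.α) * net.P k) /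
    ((∑ q ∈ Finset.univ.erase k, net.h q j ^ 2 * net.d q j ^ (-net.α) * net.P q) + net.σ ^ 2)

/-- Channel capacity between SBS `k` and user `j`. -/
def capacity (k : Fin K) (j : Fin J) : ℝ :=
  net.W * Real.log (1 + net.sinr k j)

open Classical in
/-- `H(j)`: the SBSs adjacent to user `j` in the factor graph. -/
def nbrMU (j : Fin J) : Finset (Fin K) :=
  Finset.univ.filter fun k => net.δ ≤ net.sinr k j

open Classical in
/-- `H(k)`: the users adjacent to SBS `k` in the factor graph. -/
def nbrSBS (k : Fin K) : Finset (Fin J) :=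
  Finset.univ.filter fun j => net.δ ≤ net.sinr k j

/-- Probability that a file of the `n`-th file group is requested; counting from zero, this
group consists of the files `n * G, …, (n + 1) * G - 1`. -/
def groupProb (n : Fin N) : ℝ :=
  ∑ f : Fin (N * G) with n.val * G ≤ f.val ∧ f.val < (n.val + 1) * G, net.p f

/-- The value of a row of the placement matrix that says that file group `n` is cached: the
`0`-`1` vector of length `N` whose only `1` is at position `n`. -/
def row (n : Fin N) : Fin N → ℝ := Pi.single n 1

open Classical in
/-- Delay for user `j` of downloading a file of group `n`, when the rows of the placement matrix
of the adjacent SBSs are `Λ`. -/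
def groupDelay (j : Fin J) (Λ : net.nbrMU j → Fin N → ℝ) (n : Fin N) : ℝ :=
  if ∃ h, Λ h n ≠ 0 then net.M / ⨆ h, Λ h n * net.capacity h j else net.M / net.C₀

/-- Average delay of user `j`. -/
def delay (j : Fin J) (Λ : net.nbrMU j → Fin N → ℝ) : ℝ :=
  ∑ n, net.groupProb n * net.groupDelay j Λ n

/-- Local utility function of the factor node `j`. -/
def utility (j : Fin J) (Λ : net.nbrMU j → Fin N → ℝ) : ℝ :=
  -net.delay j Λ

/-- The rows of the placement matrix of the SBSs adjacent to `j`, when SBS `k` caches group `n`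
and every other adjacent SBS `h` caches group `x h`. -/
def localPlacement (j : Fin J) (k : Fin K) (n : Fin N)
    (x : (net.nbrMU j).erase k → Fin N) : net.nbrMU j → Fin N → ℝ :=
  fun h => if hk : h.val = k then row n
    else row (x ⟨h.val, Finset.mem_erase.2 ⟨hk, h.property⟩⟩)

/-- Factor node update: the message from user `j` to SBS `k`, computed from the messages
`m q j` from the SBSs `q` to `j`. The sum runs over all joint values of the rows of
the SBSs in `H(j) \ {k}`. -/
def factorUpdate (μ : ℝ) (m : Fin K → Fin J → Fin N → ℝ) : Fin J → Fin K → Fin N → ℝ :=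
  fun j k n => ∑ x : (net.nbrMU j).erase k → Fin N,
    (∏ q, m q.val j (x q)) * Real.exp (μ * net.utility j (net.localPlacement j k n x))

/-- Variable node update: the message from SBS `k` to user `j`, computed from the messages
`r i k` from the users `i` to `k`, and normalized to total mass one. -/
def variableUpdate (r : Fin J → Fin K → Fin N → ℝ) : Fin K → Fin J → Fin N → ℝ :=
  fun k j n => (∏ i ∈ (net.nbrSBS k).erase j, r i k n) /
    ∑ n', ∏ i ∈ (net.nbrSBS k).erase j, r i k n'

/-- The message mapping function `Γ` of one iteration of distributed belief propagation. -/
def Γ (μ : ℝ) (m : Fin K → Fin J → Fin N → ℝ) : Fin K → Fin J → Fin N → ℝ :=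
  net.variableUpdate (net.factorUpdate μ m)

end

end HCN

/-- The collections of messages: one probability vector of length `N` for each SBS `k` and
each user `j`. -/
def messageCollections (K J N : ℕ) : Set (Fin K → Fin J → Fin N → ℝ) :=
  {m | ∀ k j, m k j ∈ stdSimplex ℝ (Fin N)}

/-! The message space is a product of simplices, hence compact and convex, and nonempty because a
library carrying a probability vector has `N ≠ 0`. Every factor message is a sum of nonnegative
terms with exponential weights, at least one of them positive, so no normalization vanishes and `Γ`
is a continuous self-map. Brouwer's theorem then gives the fixed point.

Brouwer's theorem is proved analytically, in the manner of Milnor and Rogers. If `r` were a C¹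
retraction of a ball onto its sphere, `x + t (r x - x)` would permute the open ball for small `t ≥
0`, so the integral of its Jacobian, a polynomial in `t`, would equal the volume of the ball for
small `t` and hence at `t = 1`. There the Jacobian is zero, since `r` takes values in a sphere
(`not_contDiffOn_retraction_sphere`). A C¹ map without fixed points would yield such a retraction;
approximation handles continuous maps, and nearest point projection handles compact convex sets. -/

/-! ### Nearest point projections -/

/-- The nearest point map onto a closed convex set is a nonexpansive retraction. -/
theorem exists_nonexpansive_projection {E : Type*} [NormedAddCommGroup E] [InnerProductSpace ℝ E]
    [CompleteSpace E] {s : Set E} (hc : Convex ℝ s) (hs : IsClosed s) (hne : s.Nonempty) :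
    ∃ π : E → E, LipschitzWith 1 π ∧ (∀ x, π x ∈ s) ∧
      ∀ x, ∀ z ∈ s, inner ℝ (x - π x) (z - π x) ≤ 0 := by
  have h : ∀ x, ∃ p ∈ s, ∀ z ∈ s, inner ℝ (x - p) (z - p) ≤ 0 := by
    intro x
    obtain ⟨p, hp, hx⟩ := exists_norm_eq_iInf_of_complete_convex hne hs.isComplete hc x
    exact ⟨p, hp, (norm_eq_iInf_iff_real_inner_le_zero hc hp).1 hx⟩
  choose π hπ hin using h
  refine ⟨π, LipschitzWith.of_dist_le_mul fun x y => ?_, hπ, hin⟩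
  rw [NNReal.coe_one, one_mul, dist_eq_norm, dist_eq_norm]
  have h1 := hin x (π y) (hπ y)
  have h2 := hin y (π x) (hπ x)
  -- Adding the two variational inequalities gives this; Cauchy–Schwarz then finishes.
  have h3 : ‖π x - π y‖ ^ 2 ≤ inner ℝ (x - y) (π x - π y) := by
    have : inner ℝ (x - y) (π x - π y) = ‖π x - π y‖ ^ 2
        - inner ℝ (x - π x) (π y - π x) - inner ℝ (y - π y) (π x - π y) := by
      rw [← real_inner_self_eq_norm_sq, ← neg_sub (π x) (π y), inner_neg_right, sub_neg_eq_add,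
        ← inner_add_left, ← inner_sub_left]
      congr 1
      abel
    linarith
  have h4 := real_inner_le_norm (x - y) (π x - π y)
  by_contra! hlt
  nlinarith [norm_nonneg (x - y)]

/-- A nearest point map onto a ball sends points outside the ball to the bounding sphere. -/
theorem norm_eq_of_projection_ball {E : Type*} [NormedAddCommGroup E] [InnerProductSpace ℝ E]
    {R : ℝ} {x p : E} (hp : ‖p‖ ≤ R) (hx : R < ‖x‖)
    (h : ∀ z ∈ Metric.closedBall (0 : E) R, inner ℝ (x - p) (z - p) ≤ 0) : ‖p‖ = R := by
  by_contra hne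
  have hlt : ‖p‖ < R := lt_of_le_of_ne hp hne
  have hxp : 0 < ‖x - p‖ := by
    rw [norm_pos_iff, sub_ne_zero]
    rintro rfl
    linarith
  -- A step of length `R - ‖p‖` from `p` towards `x` stays in the ball, yet has positive inner
  -- product with `x - p`.
  set c := (R - ‖p‖) / ‖x - p‖ with hc
  have hc0 : 0 < c := div_pos (by linarith) hxp
  have hz : p + c • (x - p) ∈ Metric.closedBall (0 : E) R := by
    rw [mem_closedBall_zero_iff]
    refine (norm_add_le _ _).trans ?_
    rw [norm_smul, Real.norm_of_nonneg hc0.le, hc, div_mul_cancel₀ _ hxp.ne']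
    linarith
  have := h _ hz
  rw [add_sub_cancel_left, inner_smul_right, real_inner_self_eq_norm_sq] at this
  have : 0 < c * ‖x - p‖ ^ 2 := by positivity
  linarith

/-! ### Determinants along the line `1 + t A` -/

/-- `t ↦ det (1 + t A)` is a polynomial of degree at most the dimension, hence is recovered
by Lagrange interpolation. -/
theorem ContinuousLinearMap.det_one_add_smul_eq_sum_lagrange {E : Type*} [NormedAddCommGroup E]
    [NormedSpace ℝ E] [FiniteDimensional ℝ E] (A : E →L[ℝ] E) {s : Finset ℕ} {v : ℕ → ℝ}
    (hv : Set.InjOn v s) (hs : Module.finrank ℝ E < s.card) (t : ℝ) :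
    (1 + t • A).det = ∑ i ∈ s, (1 + v i • A).det * (Lagrange.basis s v i).eval t := by
  classical
  let b := Module.finBasis ℝ E
  let M := LinearMap.toMatrix b b (A : E →ₗ[ℝ] E)
  let q : Polynomial ℝ := Matrix.det
    ((Polynomial.X : Polynomial ℝ) • M.map Polynomial.C
      + (1 : Matrix _ _ ℝ).map Polynomial.C)
  have hq : ∀ t, q.eval t = (1 + t • A).det := by
    intro t
    have h1 : (1 + t • A).det = (1 + t • M).det := by
      rw [ContinuousLinearMap.det, ← LinearMap.det_toMatrix b]
      congr 1
      simp [M, LinearMap.toMatrix_one]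
    rw [h1]
    simp only [q]
    rw [← Polynomial.coe_evalRingHom, RingHom.map_det]
    congr 1
    ext i j
    by_cases hij : i = j <;>
      simp [hij, Matrix.add_apply, Matrix.smul_apply, add_comm] <;> exact mul_comm _ _
  have hdeg : q.degree < s.card := by
    refine lt_of_le_of_lt Polynomial.degree_le_natDegree ?_
    exact_mod_cast lt_of_le_of_lt (Polynomial.natDegree_det_X_add_C_le M 1) (by simpa using hs)
  have := congrArg (Polynomial.eval t) (Lagrange.eq_interpolate hv hdeg)
  rw [hq, Lagrange.interpolate_apply, Polynomial.eval_finsetSum] at this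
  simpa [hq] using this

/-- The determinant of `1 + t A` is positive when `t A` has norm less than one. -/
theorem ContinuousLinearMap.det_one_add_smul_pos {E : Type*} [NormedAddCommGroup E]
    [NormedSpace ℝ E] [FiniteDimensional ℝ E] {A : E →L[ℝ] E} {t : ℝ} (ht : 0 ≤ t)
    (hA : t * ‖A‖ < 1) : 0 < (1 + t • A).det := by
  by_contra! hneg
  have hcont : ContinuousOn (fun s : ℝ => (1 + s • A).det) (Set.Icc 0 t) :=
    (ContinuousLinearMap.continuous_det.comp (by fun_prop)).continuousOn
  have h0 : ((1 : E →L[ℝ] E) + (0 : ℝ) • A).det = 1 := by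
    rw [zero_smul, add_zero]
    exact LinearMap.det_id
  -- The determinant is `1` at `0`, so it would vanish at some `s ≤ t`, where the Neumann series
  -- makes `1 + s • A` invertible.
  obtain ⟨s, hs, hs0⟩ := intermediate_value_Icc' ht hcont
    (show (0 : ℝ) ∈ Set.Icc _ _ from ⟨hneg, by rw [h0]; exact zero_le_one⟩)
  have hlt : ‖-(s • A)‖ < 1 := by
    rw [norm_neg, norm_smul, Real.norm_of_nonneg hs.1]
    exact lt_of_le_of_lt (mul_le_mul_of_nonneg_right hs.2 (norm_nonneg _)) hA
  have hu : IsUnit ((1 : E →L[ℝ] E) + s • A) := by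
    simpa using (isUnit_one_sub_of_norm_lt_one hlt)
  have hu' : IsUnit (((1 : E →L[ℝ] E) + s • A : E →L[ℝ] E) : E →ₗ[ℝ] E) :=
    hu.map (ContinuousLinearMap.toLinearMapRingHom : (E →L[ℝ] E) →+* (E →ₗ[ℝ] E))
  exact (LinearMap.isUnit_iff_isUnit_det _).1 hu' |>.ne_zero hs0

/-! ### No C¹ retraction onto the sphere -/

/-- A Lipschitz displacement field vanishing on the bounding sphere, scaled by a small factor,
moves the ball bijectively onto itself. -/
theorem image_ball_add_smul {E : Type*} [NormedAddCommGroup E] [InnerProductSpace ℝ E]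
    [CompleteSpace E] {R : ℝ} (hR : 0 < R) {r : E → E} {C : NNReal}
    (hr : LipschitzOnWith C (fun x => r x - x) (Metric.closedBall 0 R))
    (hball : ∀ x ∈ Metric.closedBall (0 : E) R, ‖r x‖ ≤ R) (hsph : ∀ x, ‖x‖ = R → r x = x)
    {t : ℝ} (ht : 0 ≤ t) (ht1 : t < 1) (hC : t * C < 1) :
    Set.InjOn (fun x => x + t • (r x - x)) (Metric.ball 0 R) ∧
      (fun x => x + t • (r x - x)) '' Metric.ball 0 R = Metric.ball 0 R := by
  have hinj : Set.InjOn (fun x => x + t • (r x - x)) (Metric.closedBall 0 R) := by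
    intro x hx y hy hxy
    by_contra hne
    have h1 := hr.dist_le_mul x hx y hy
    simp only [dist_eq_norm] at h1 hxy
    have h2 : x - y = t • ((r y - y) - (r x - x)) := by
      rw [smul_sub, sub_eq_sub_iff_add_eq_add, add_comm (t • _) y]
      exact hxy
    have h3 : ‖x - y‖ = t * ‖(r x - x) - (r y - y)‖ := by
      conv_lhs => rw [h2, norm_smul, Real.norm_of_nonneg ht, norm_sub_rev]
    have h4 : 0 < ‖x - y‖ := norm_pos_iff.2 (sub_ne_zero.2 hne)
    have := mul_le_mul_of_nonneg_left h1 ht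
    nlinarith
  refine ⟨hinj.mono Metric.ball_subset_closedBall, Set.Subset.antisymm ?_ ?_⟩
  · rintro _ ⟨x, hx, rfl⟩
    have h1 := hball x (Metric.ball_subset_closedBall hx)
    rw [mem_ball_zero_iff] at hx ⊢
    have h2 : x + t • (r x - x) = (1 - t) • x + t • r x := by module
    simp only [h2]
    refine (norm_add_le _ _).trans_lt ?_
    rw [norm_smul, norm_smul, Real.norm_of_nonneg ht, Real.norm_of_nonneg (by linarith)]
    nlinarith
  · intro y hy
    obtain ⟨π, hπl, hπs, hπi⟩ := exists_nonexpansive_projection (convex_closedBall (0 : E) R)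
      Metric.isClosed_closedBall ⟨0, by simpa using hR.le⟩
    have hlip : LipschitzWith C (fun x => r (π x) - π x) := by
      have := hr.comp (hπl.lipschitzOnWith (s := Set.univ)) (fun x _ => hπs x)
      simpa [lipschitzOnWith_univ, Function.comp_def] using this
    -- Precomposing with `π` extends the displacement to all of `E`, so a preimage of `y` can be
    -- sought as the fixed point of a contraction. Were it outside the ball, its projection would
    -- lie on the sphere, where the displacement is zero, forcing `x = y`.
    have hcontr : ContractingWith (t.toNNReal * C) (fun x => y - t • (r (π x) - π x)) := by
      refine ⟨by rw [← NNReal.coe_lt_coe]; simpa [ht] using hC,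
        LipschitzWith.of_dist_le_mul fun a b => ?_⟩
      have := hlip.dist_le_mul a b
      rw [dist_sub_left, dist_smul₀, Real.norm_of_nonneg ht, NNReal.coe_mul,
        Real.coe_toNNReal t ht, mul_assoc]
      exact mul_le_mul_of_nonneg_left this ht
    set x := hcontr.fixedPoint with hxdef
    have hx : y - t • (r (π x) - π x) = x := hcontr.fixedPoint_isFixedPt
    rw [mem_ball_zero_iff] at hy
    have hout : ∀ z : E, ‖z‖ = R → r z - z = 0 := fun z hz => by rw [hsph z hz, sub_self]
    have hxR : ‖x‖ ≤ R := by
      by_contra! hlt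
      have hp := norm_eq_of_projection_ball (by simpa using hπs x) hlt (hπi x)
      rw [hout _ hp, smul_zero, sub_zero] at hx
      rw [← hx] at hlt
      linarith
    have hπx : π x = x := by
      have := hπi x x (by simpa using hxR)
      rw [real_inner_self_nonpos, sub_eq_zero] at this
      exact this.symm
    rw [hπx] at hx
    refine ⟨x, ?_, ?_⟩
    · rw [mem_ball_zero_iff]
      refine lt_of_le_of_ne hxR fun h => ?_
      rw [hout _ h, smul_zero, sub_zero] at hx
      rw [hx] at hy
      linarith
    · exact (sub_eq_iff_eq_add.1 hx).symm

open MeasureTheory in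
/-- There is no continuously differentiable retraction of a ball onto its bounding sphere. -/
theorem not_contDiffOn_retraction_sphere {E : Type*} [NormedAddCommGroup E]
    [InnerProductSpace ℝ E] [FiniteDimensional ℝ E] {R : ℝ} (hR : 0 < R) {U : Set E}
    (hU : IsOpen U) (hUR : Metric.closedBall 0 R ⊆ U) {r : E → E} (hr : ContDiffOn ℝ 1 r U)
    (hball : ∀ x ∈ Metric.closedBall (0 : E) R, ‖r x‖ = R) (hsph : ∀ x, ‖x‖ = R → r x = x) :
    False := by
  borelize E
  let A : E → E →L[ℝ] E := fun x => fderiv ℝ r x - 1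
  have hder : ∀ x ∈ Metric.closedBall (0 : E) R, HasFDerivAt r (fderiv ℝ r x) x := fun x hx =>
    ((hr.differentiableOn one_ne_zero).differentiableAt (hU.mem_nhds (hUR hx))).hasFDerivAt
  have hder' : ∀ x ∈ Metric.closedBall (0 : E) R, HasFDerivAt (fun x => r x - x) (A x) x :=
    fun x hx => (hder x hx).sub (hasFDerivAt_id x)
  have hAc : ContinuousOn A (Metric.closedBall 0 R) :=
    ((hr.continuousOn_fderiv_of_isOpen hU le_rfl).mono hUR).sub continuousOn_const
  obtain ⟨C₀, hC₀⟩ := (isCompact_closedBall (0 : E) R).exists_bound_of_continuousOn hAc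
  let C : NNReal := ⟨max C₀ 0, le_max_right _ _⟩
  have hAC : ∀ x ∈ Metric.closedBall (0 : E) R, ‖A x‖ ≤ C := fun x hx =>
    (hC₀ x hx).trans (le_max_left _ _)
  have hlip : LipschitzOnWith C (fun x => r x - x) (Metric.closedBall 0 R) :=
    (convex_closedBall (0 : E) R).lipschitzOnWith_of_nnnorm_hasFDerivWithin_le
      (fun x hx => (hder' x hx).hasFDerivWithinAt) hAC
  have hint : ∀ t : ℝ, IntegrableOn (fun x => (1 + t • A x).det) (Metric.ball (0 : E) R) := by
    intro t
    refine (ContinuousOn.integrableOn_compact (isCompact_closedBall (0 : E) R) ?_).mono_set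
      Metric.ball_subset_closedBall
    exact ContinuousLinearMap.continuous_det.comp_continuousOn
      (continuousOn_const.add (hAc.const_smul t))
  have hvol : ∀ t : ℝ, 0 ≤ t → t < 1 → t * C < 1 →
      ∫ x in Metric.ball (0 : E) R, (1 + t • A x).det = volume.real (Metric.ball (0 : E) R) := by
    intro t ht ht1 htC
    obtain ⟨hinj, himg⟩ :=
      image_ball_add_smul hR hlip (fun x hx => (hball x hx).le) hsph ht ht1 htC
    have h1 := integral_image_eq_integral_abs_det_fderiv_smul volume
      (Metric.isOpen_ball (x := (0 : E)) (ε := R)).measurableSet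
      (f' := fun x => 1 + t • A x) (fun x hx =>
        ((hasFDerivAt_id x).add ((hder' x (Metric.ball_subset_closedBall hx)).const_smul
          t)).hasFDerivWithinAt) hinj (fun _ => (1 : ℝ))
    have h2 : (id + t • fun x => r x - x) '' Metric.ball 0 R = Metric.ball 0 R := himg
    rw [h2, setIntegral_const, smul_eq_mul, mul_one] at h1
    rw [h1]
    refine setIntegral_congr_fun Metric.isOpen_ball.measurableSet fun x hx => ?_
    have hpos := ContinuousLinearMap.det_one_add_smul_pos ht (A := A x)
      (lt_of_le_of_lt (mul_le_mul_of_nonneg_left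
        (hAC x (Metric.ball_subset_closedBall hx)) ht) htC)
    simp only [smul_eq_mul, mul_one, abs_of_pos hpos]
  -- At `t = 1` the operator is the derivative of `r`. As `‖r‖` is constant on the ball, its range
  -- is orthogonal to `r x ≠ 0`, so it is not surjective.
  have hsing : ∀ x ∈ Metric.ball (0 : E) R, (1 + (1 : ℝ) • A x).det = 0 := by
    intro x hx
    have hxc := Metric.ball_subset_closedBall hx
    have hrx : r x ≠ 0 := by
      rw [← norm_pos_iff, hball x hxc]
      exact hR
    have horth : ∀ y, inner ℝ (r x) (fderiv ℝ r x y) = 0 := by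
      intro y
      have h1 := (hder x hxc).norm_sq
      have h2 : HasFDerivAt (fun z => ‖r z‖ ^ 2) (0 : E →L[ℝ] ℝ) x := by
        refine (hasFDerivAt_const (R ^ 2) x).congr_of_eventuallyEq ?_
        filter_upwards [Metric.isOpen_ball.mem_nhds hx] with z hz
        rw [hball z (Metric.ball_subset_closedBall hz)]
      have h3 := congrArg (fun L : E →L[ℝ] ℝ => L y) (h1.unique h2)
      simpa using h3
    rw [one_smul, add_sub_cancel]
    by_contra hdet
    have hu := (LinearMap.isUnit_iff_isUnit_det (fderiv ℝ r x : E →ₗ[ℝ] E)).2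
      (isUnit_iff_ne_zero.2 hdet)
    obtain ⟨y, hy⟩ := ((Module.End.isUnit_iff _).1 hu).2 (r x)
    have := horth y
    rw [show fderiv ℝ r x y = r x from hy, inner_self_eq_zero] at this
    exact hrx this
  let n := Module.finrank ℝ E
  -- These are `n + 1` distinct nodes, enough for degree `n`; `v i * (C + 1) < 1` yields both `v i <
  -- 1` and `v i * C < 1`, as `hvol` requires.
  let v : ℕ → ℝ := fun i => (i : ℝ) / ((n + 1) * (C + 1))
  have hC1 : (0 : ℝ) < C + 1 := by positivity
  have hD : (0 : ℝ) < (n + 1) * (C + 1) := by positivity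
  have hv : Set.InjOn v (Finset.range (n + 1)) := by
    intro i _ j _ hij
    have : (i : ℝ) = j := (div_left_inj' hD.ne').1 hij
    exact_mod_cast this
  have hvs : ∀ i ∈ Finset.range (n + 1), v i * (C + 1) < 1 := by
    intro i hi
    have : (i : ℝ) < n + 1 := by exact_mod_cast Finset.mem_range.1 hi
    simp only [v]
    rw [div_mul_eq_mul_div, div_lt_one hD]
    exact mul_lt_mul_of_pos_right this hC1
  have hv0 : ∀ i, 0 ≤ v i := fun i => by positivity
  have hcard : n < (Finset.range (n + 1)).card := by simp
  have hsum : ∫ x in Metric.ball (0 : E) R, (1 + (1 : ℝ) • A x).det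
      = volume.real (Metric.ball (0 : E) R) := by
    calc ∫ x in Metric.ball (0 : E) R, (1 + (1 : ℝ) • A x).det
        = ∫ x in Metric.ball (0 : E) R, ∑ i ∈ Finset.range (n + 1), (1 + v i • A x).det *
            (Lagrange.basis (Finset.range (n + 1)) v i).eval 1 := by
          simp_rw [← ContinuousLinearMap.det_one_add_smul_eq_sum_lagrange _ hv hcard 1]
      _ = ∑ i ∈ Finset.range (n + 1), volume.real (Metric.ball (0 : E) R) *
            (Lagrange.basis (Finset.range (n + 1)) v i).eval 1 := by
          rw [integral_finsetSum _ fun i _ => (hint (v i)).mul_const _]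
          refine Finset.sum_congr rfl fun i hi => ?_
          have hi1 := hvs i hi
          have hC0 : (0 : ℝ) ≤ C := C.coe_nonneg
          have := hv0 i
          rw [integral_mul_const, hvol (v i) this (by nlinarith) (by nlinarith)]
      _ = volume.real (Metric.ball (0 : E) R) := by
          rw [← Finset.mul_sum, ← Polynomial.eval_finsetSum, Lagrange.sum_basis hv (by simp),
            Polynomial.eval_one, mul_one]
  rw [setIntegral_congr_fun Metric.isOpen_ball.measurableSet hsing, integral_zero] at hsum
  have : 0 < volume.real (Metric.ball (0 : E) R) :=
    ENNReal.toReal_pos (Metric.measure_ball_pos _ _ hR).ne' measure_ball_lt_top.ne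
  linarith

/-! ### Brouwer's fixed point theorem -/

/-- The factor by which the ray from a point of a ball in direction `u` has to be stretched to
reach the bounding sphere solves the corresponding quadratic equation. -/
theorem norm_add_smul_eq_of_quadratic {E : Type*} [NormedAddCommGroup E] [InnerProductSpace ℝ E]
    {R : ℝ} (hR : 0 < R) {x u : E} (hu : u ≠ 0)
    (hD : 0 ≤ inner ℝ x u ^ 2 + ‖u‖ ^ 2 * (R ^ 2 - ‖x‖ ^ 2)) :
    ‖x + ((-inner ℝ x u + √(inner ℝ x u ^ 2 + ‖u‖ ^ 2 * (R ^ 2 - ‖x‖ ^ 2))) / ‖u‖ ^ 2) • u‖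
      = R := by
  have hu' : ‖u‖ ^ 2 ≠ 0 := pow_ne_zero _ (norm_ne_zero_iff.2 hu)
  have hsq := Real.sq_sqrt hD
  set w := √(inner ℝ x u ^ 2 + ‖u‖ ^ 2 * (R ^ 2 - ‖x‖ ^ 2))
  have key : ‖x + ((-inner ℝ x u + w) / ‖u‖ ^ 2) • u‖ ^ 2 = R ^ 2 := by
    rw [norm_add_sq_real, inner_smul_right, norm_smul, mul_pow, Real.norm_eq_abs, sq_abs]
    set a := inner ℝ x u
    set b := ‖u‖ ^ 2
    field_simp
    linear_combination hsq
  exact (sq_eq_sq₀ (norm_nonneg _) hR.le).1 key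

/-- A continuously differentiable map into the interior of a ball has a fixed point in the ball. -/
theorem exists_isFixedPt_closedBall_of_contDiff {E : Type*} [NormedAddCommGroup E]
    [InnerProductSpace ℝ E] [FiniteDimensional ℝ E] {R : ℝ} (hR : 0 < R) {g : E → E}
    (hg : ContDiff ℝ 1 g) (hgR : ∀ x, ‖g x‖ < R) :
    ∃ x ∈ Metric.closedBall (0 : E) R, Function.IsFixedPt g x := by
  by_contra! hfix
  let u : E → E := fun x => x - g x
  let D : E → ℝ := fun x => inner ℝ x (u x) ^ 2 + ‖u x‖ ^ 2 * (R ^ 2 - ‖x‖ ^ 2)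
  have hu : ContDiff ℝ 1 u := contDiff_id.sub hg
  have hD : ContDiff ℝ 1 D :=
    ((contDiff_id.inner ℝ hu).pow 2).add
      ((hu.norm_sq ℝ).mul (contDiff_const.sub (contDiff_id.norm_sq ℝ)))
  have hu0 : ∀ x ∈ Metric.closedBall (0 : E) R, u x ≠ 0 := fun x hx h =>
    hfix x hx (sub_eq_zero.1 h).symm
  have hsph : ∀ x, ‖x‖ = R → 0 < inner ℝ x (u x) := by
    intro x hx
    have h1 := real_inner_le_norm x (g x)
    have h2 := hgR x
    simp only [u]
    rw [inner_sub_right, real_inner_self_eq_norm_sq]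
    rw [hx] at h1 ⊢
    nlinarith
  -- Strict positivity up to the sphere keeps the square root differentiable on a neighbourhood of
  -- the closed ball.
  have hDpos : ∀ x ∈ Metric.closedBall (0 : E) R, 0 < D x := by
    intro x hx
    have hux : 0 < ‖u x‖ := norm_pos_iff.2 (hu0 x hx)
    rw [mem_closedBall_zero_iff] at hx
    rcases hx.eq_or_lt with h | h
    · have := hsph x h
      simp only [D, h, sub_self, mul_zero, add_zero]
      positivity
    · have : 0 < R ^ 2 - ‖x‖ ^ 2 := by nlinarith [norm_nonneg x]
      simp only [D]
      positivity
  -- The retraction sends `x` to the point where the ray from `x` pointing away from `g x` meets the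
  -- sphere.
  refine not_contDiffOn_retraction_sphere hR (U := {x | 0 < D x} ∩ {x | u x ≠ 0})
    (r := fun x => x + ((-inner ℝ x (u x) + √(D x)) / ‖u x‖ ^ 2) • u x) ?_ ?_ ?_ ?_ ?_
  · exact (isOpen_lt continuous_const hD.continuous).inter
      (isOpen_ne_fun hu.continuous continuous_const)
  · exact fun x hx => ⟨hDpos x hx, hu0 x hx⟩
  · refine contDiffOn_id.add (ContDiffOn.smul (ContDiffOn.div ?_ (hu.norm_sq ℝ).contDiffOn ?_)
      hu.contDiffOn)
    · exact (contDiff_id.inner ℝ hu).neg.contDiffOn.add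
        (hD.contDiffOn.sqrt fun x hx => (ne_of_gt hx.1))
    · exact fun x hx => pow_ne_zero _ (norm_ne_zero_iff.2 hx.2)
  · exact fun x hx => norm_add_smul_eq_of_quadratic hR (hu0 x hx) (hDpos x hx).le
  · intro x hx
    have : D x = inner ℝ x (u x) ^ 2 := by simp [D, hx]
    simp only [this, Real.sqrt_sq (hsph x hx).le, neg_add_cancel, zero_div, zero_smul, add_zero]

/-- A bounded continuous self-map of a finite-dimensional inner product space has a fixed point. -/
theorem Continuous.exists_isFixedPt_of_norm_le {E : Type*} [NormedAddCommGroup E]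
    [InnerProductSpace ℝ E] [FiniteDimensional ℝ E] {f : E → E} (hf : Continuous f) {R : ℝ}
    (hfR : ∀ x, ‖f x‖ ≤ R) : ∃ x, Function.IsFixedPt f x := by
  have hR : 0 < R + 1 := by linarith [(norm_nonneg _).trans (hfR 0)]
  obtain ⟨x, -, hmin⟩ := (isCompact_closedBall (0 : E) (R + 1)).exists_isMinOn
    ⟨0, by simpa using hR.le⟩ (f := fun x => dist (f x) x)
    (hf.dist continuous_id).continuousOn
  refine ⟨x, ?_⟩
  by_contra hx
  have hpos : 0 < dist (f x) x := dist_pos.2 hx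
  -- The bound `1` keeps `g` inside the ball of radius `R + 1`; the other bound is the least
  -- displacement of `f` on that ball, which a fixed point of `g` would undercut.
  obtain ⟨g, hg, hgf, -⟩ := hf.exists_contDiff_approx 1
    (ε := fun _ => min 1 (dist (f x) x)) continuous_const fun _ => lt_min one_pos hpos
  obtain ⟨y, hy, hgy⟩ := exists_isFixedPt_closedBall_of_contDiff hR (by exact_mod_cast hg)
    fun z => by
      have h1 := (hgf z).trans_le (min_le_left _ _)
      rw [dist_eq_norm] at h1
      have h2 := norm_add_le (g z - f z) (f z)
      rw [sub_add_cancel] at h2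
      linarith [hfR z]
  have h1 := (hgf y).trans_le (min_le_right _ _)
  rw [hgy.eq, dist_comm] at h1
  exact absurd (isMinOn_iff.1 hmin y hy) (not_le.2 h1)

/-- **Brouwer fixed point theorem** for compact convex sets. -/
theorem ContinuousOn.exists_isFixedPt_of_convex_isCompact {E : Type*} [NormedAddCommGroup E]
    [NormedSpace ℝ E] [FiniteDimensional ℝ E] {s : Set E} (hc : Convex ℝ s) (hs : IsCompact s)
    (hne : s.Nonempty) {f : E → E} (hf : ContinuousOn f s) (hfs : Set.MapsTo f s s) :
    ∃ x ∈ s, Function.IsFixedPt f x := by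
  -- The norm of `E` need not come from an inner product, which the projection needs.
  let e : E ≃L[ℝ] EuclideanSpace ℝ (Fin (Module.finrank ℝ E)) := toEuclidean
  have ht : IsCompact (e '' s) := hs.image e.continuous
  obtain ⟨π, hπ, hπs, hπi⟩ := exists_nonexpansive_projection
    (hc.linear_image (e : E →ₗ[ℝ] EuclideanSpace ℝ (Fin (Module.finrank ℝ E))))
    ht.isClosed (hne.image e)
  have hmem : ∀ y, e.symm (π y) ∈ s := by
    intro y
    obtain ⟨x, hx, hxy⟩ := hπs y
    rw [← show e x = π y from hxy]
    simpa using hx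
  have hcont : Continuous fun y => e (f (e.symm (π y))) :=
    e.continuous.comp (hf.comp_continuous (e.symm.continuous.comp hπ.continuous) hmem)
  obtain ⟨R, hR⟩ := ht.isBounded.exists_norm_le
  obtain ⟨y, hy⟩ := hcont.exists_isFixedPt_of_norm_le
    fun y => hR _ ⟨_, hfs (hmem y), rfl⟩
  have hy' : e (f (e.symm (π y))) = y := hy
  -- The fixed point is a value of the map, so it lies in `e '' s`, where `π` is the identity.
  have hys : y ∈ e '' s := ⟨_, hfs (hmem y), hy'⟩
  have hπy : π y = y := by
    have := hπi y y hys
    rw [real_inner_self_nonpos, sub_eq_zero] at this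
    exact this.symm
  refine ⟨e.symm (π y), hmem y, ?_⟩
  apply e.injective
  rw [hy', e.apply_symm_apply, hπy]

/-! ### The belief propagation map on the message space -/

theorem convex_messageCollections (K J N : ℕ) : Convex ℝ (messageCollections K J N) :=
  fun _ hx _ hy _ _ ha hb hab k j => convex_stdSimplex ℝ (Fin N) (hx k j) (hy k j) ha hb hab

theorem isCompact_messageCollections (K J N : ℕ) : IsCompact (messageCollections K J N) := by
  have : messageCollections K J N =
      Set.univ.pi fun _ : Fin K => Set.univ.pi fun _ : Fin J => stdSimplex ℝ (Fin N) := by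
    ext m
    simp [messageCollections]
  rw [this]
  exact isCompact_univ_pi fun _ => isCompact_univ_pi fun _ => isCompact_stdSimplex ℝ (Fin N)

namespace HCN

theorem numGroups_ne_zero {K J N G : ℕ} (net : HCN K J N G) : N ≠ 0 := by
  rintro rfl
  have h := net.p_sum
  have : IsEmpty (Fin (0 * G)) := by
    rw [Nat.zero_mul]
    infer_instance
  simp at h

variable {K J N G : ℕ} (net : HCN K J N G)

/-- A product of probability vectors has a tuple of positive weight. -/
theorem exists_forall_pos {ι : Type*} {w : ι → Fin N → ℝ} (hw : ∀ q, w q ∈ stdSimplex ℝ (Fin N)) :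
    ∃ x : ι → Fin N, ∀ q, 0 < w q (x q) := by
  have : ∀ q, ∃ n, 0 < w q n := by
    intro q
    obtain ⟨n, -, hn⟩ := Finset.exists_lt_of_sum_lt (s := Finset.univ) (f := fun _ => (0 : ℝ))
      (g := w q) (by rw [(hw q).2]; simp)
    exact ⟨n, hn⟩
  choose x hx using this
  exact ⟨x, hx⟩

/-- Messages may have zero entries, but some tuple has positive weight and the exponential never
vanishes. If no other SBS is adjacent, the empty tuple serves. -/
theorem factorUpdate_pos (μ : ℝ) {m : Fin K → Fin J → Fin N → ℝ}
    (hm : m ∈ messageCollections K J N) (j : Fin J) (k : Fin K) (n : Fin N) :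
    0 < net.factorUpdate μ m j k n := by
  obtain ⟨x, hx⟩ := exists_forall_pos
    (w := fun q : (net.nbrMU j).erase k => m q.val j) (fun q => hm q.val j)
  refine Finset.sum_pos' (fun y _ => ?_) ⟨x, Finset.mem_univ x, ?_⟩
  · exact mul_nonneg (Finset.prod_nonneg fun q _ => (hm q.val j).1 _) (Real.exp_pos _).le
  · exact mul_pos (Finset.prod_pos fun q _ => hx q) (Real.exp_pos _)

theorem normalization_pos (μ : ℝ) {m : Fin K → Fin J → Fin N → ℝ}
    (hm : m ∈ messageCollections K J N) (k : Fin K) (j : Fin J) :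
    0 < ∑ n, ∏ i ∈ (net.nbrSBS k).erase j, net.factorUpdate μ m i k n := by
  have : Nonempty (Fin N) := Fin.pos_iff_nonempty.1 (Nat.pos_of_ne_zero net.numGroups_ne_zero)
  exact Finset.sum_pos (fun n _ => Finset.prod_pos fun i _ => net.factorUpdate_pos μ hm i k n)
    Finset.univ_nonempty

theorem mapsTo_Γ (μ : ℝ) :
    Set.MapsTo (net.Γ μ) (messageCollections K J N) (messageCollections K J N) := by
  intro m hm k j
  have hZ := net.normalization_pos μ hm k j
  refine ⟨fun n => div_nonneg
    (Finset.prod_nonneg fun i _ => (net.factorUpdate_pos μ hm i k n).le) hZ.le, ?_⟩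
  simp only [Γ, variableUpdate]
  rw [← Finset.sum_div, div_self hZ.ne']

theorem continuous_factorUpdate (μ : ℝ) (j : Fin J) (k : Fin K) (n : Fin N) :
    Continuous fun m => net.factorUpdate μ m j k n := by
  unfold factorUpdate
  fun_prop

/-- Numerator and denominator are continuous everywhere; the restriction to message collections
keeps the denominator away from zero. -/
theorem continuousOn_Γ (μ : ℝ) : ContinuousOn (net.Γ μ) (messageCollections K J N) := by
  have hprod : ∀ (k : Fin K) (j : Fin J) (n : Fin N),
      Continuous fun m => ∏ i ∈ (net.nbrSBS k).erase j, net.factorUpdate μ m i k n :=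
    fun k j n => continuous_finsetProd _ fun i _ => net.continuous_factorUpdate μ i k n
  refine continuousOn_pi.2 fun k => continuousOn_pi.2 fun j => continuousOn_pi.2 fun n => ?_
  exact (hprod k j n).continuousOn.div
    (continuous_finsetSum _ fun n' _ => hprod k j n').continuousOn
    fun m hm => (net.normalization_pos μ hm k j).ne'

end HCN

theorem messageCollections_nonempty (K J : ℕ) {N : ℕ} (hN : N ≠ 0) :
    (messageCollections K J N).Nonempty :=
  ⟨fun _ _ => Pi.single ⟨0, Nat.pos_of_ne_zero hN⟩ 1, fun _ _ => single_mem_stdSimplex ℝ _⟩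

theorem theorem1 {K J N G : ℕ} (net : HCN K J N G) (μ : ℝ) (hμ : 0 < μ) :
    Set.MapsTo (net.Γ μ) (messageCollections K J N) (messageCollections K J N) ∧
      ContinuousOn (net.Γ μ) (messageCollections K J N) ∧
      ∃ m ∈ messageCollections K J N, Function.IsFixedPt (net.Γ μ) m :=
  ⟨net.mapsTo_Γ μ, net.continuousOn_Γ μ,
    (net.continuousOn_Γ μ).exists_isFixedPt_of_convex_isCompact
      (convex_messageCollections K J N) (isCompact_messageCollections K J N)
      (messageCollections_nonempty K J net.numGroups_ne_zero) (net.mapsTo_Γ μ)⟩
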